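/- Consider the 2-mode projected system of the fish-bone suspension bridge model, with unknowns $y_1,y_2,z_1,z_2:[0,\infty)\to\mathbb R$: with $y(x,t)=\sum_{j=1}^2 y_j(t)\sin(jx)$ and $z(x,t)=\sum_{j=1}^2 z_j(t)\sin(jx)$, for $j=1,2$ and $t\ge0$, $$\ddot y_j+j^4y_j+\frac4\pi\int_0^\pi y\,(1+y^2+3z^2)\sin(jx)\,dx=0,\qquad \ddot z_j+j^2z_j+\frac{12}\pi\int_0^\pi z\,(1+3y^2+z^2)\sin(jx)\,dx=0 .$$ Its conserved energy is $$E=\frac{\dot y_1^2+\dot y_2^2}{2}+\frac{\dot z_1^2+\dot z_2^2}{6}+\frac12\sum_{j=1}^2j^4y_j^2+\frac16\sum_{j=1}^2j^2z_j^2+\frac2\pi\int_0^\pi\Big[\frac{y^4}2+\frac{z^4}2+3y^2z^2+y^2+z^2\Big]dx .$$ For $k\in\{1,2\}$ and $(\alpha,\beta)\in\mathbb R^2\setminus\{(0,0)\}$, the $k$-th vertical mode $Y_k:[0,\infty)\to\mathbb R^2$ is the vertical part of the solution $(Y_k,0)$ of this system with initial data $(y_1,y_2)(0)=\alpha e_k$,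 $(\dot y_1,\dot y_2)(0)=\beta e_k$ and $z_i(0)=\dot z_i(0)=0$ for $i=1,2$, where $e_1,e_2$ is the canonical basis of $\mathbb R^2$; $E_k=E_k(\alpha,\beta)$ is the energy of these initial data, and $\overline y_k$ is the $k$-th component of $Y_k$, with $\|\overline y_k\|_\infty=\sup_{t\ge0}|\overline y_k(t)|$. Let $P_k(t)$ be the $2\times2$ matrix such that the torsional components $\Xi=(\xi_1,\xi_2)$ of the linearization of the system around $(Y_k,0)$ satisfy $\ddot\Xi+P_k(t)\Xi=0$. The mode $Y_k$ is called torsionally stable if the trivial solution of $\ddot\Xi+P_k(t)\Xi=0$ is Lyapunov stable: for every $\varepsilon>0$ there is $\delta>0$ such that $|\Xi(0)|<\delta$ and $|\dot\Xi(0)|<\delta$ imply $|\Xi(t)|<\varepsilon$ and $|\dot\Xi(t)|<\varepsilon$ for all $t\ge0$. **Theorem.** For all $(\alpha,\beta)\ne(0,0)$: 1. The first vertical mode has the form $Y_1=(\overline y_1,0)$, and it is torsionally stable provided that $$\|\overline y_1\|_\infty\le\frac1{\sqrt3}\iff E_1\le\frac{13}{24};$$ that is, these two conditions are equivalent and each of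 them is sufficient. 2. The second vertical mode has the form $Y_2=(0,\overline y_2)$, and it is torsionally stable provided that $$\|\overline y_2\|_\infty\le\sqrt{\frac{32}{51}}\iff E_2\le\frac{5024}{867};$$ that is, these two conditions are equivalent and each of them is sufficient. -/

import Mathlib

open Set
open scoped ENNReal

namespace FishBone

/-- The pair `(Y, Z)` of the vectors of Fourier coefficients of the vertical component
`y(x) = ∑ y_j sin (j x)` and of the torsional component `z(x) = ∑ z_j sin (j x)`.
Indices start at `0` in `Fin m`, so that the entry with index `j` belongs to the mode
number `j + 1`. -/
abbrev Coeffs (m : ℕ) : Type := (Fin m → ℝ) × (Fin m → ℝ)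

/-- The sine polynomial with the given coefficients. -/
noncomputable def sineSum {m : ℕ} (c : Fin m → ℝ) (x : ℝ) : ℝ :=
  ∑ j : Fin m, c j * Real.sin (((j : ℝ) + 1) * x)

/-- The force field `F` for which the `m`-mode projected system reads
`(Y, Z)'' + F (Y, Z) = 0`. -/
noncomputable def force (m : ℕ) (q : Coeffs m) : Coeffs m :=
  (fun j => ((j : ℝ) + 1) ^ 4 * q.1 j + 4 / Real.pi * ∫ x in (0 : ℝ)..Real.pi,
      sineSum q.1 x * (1 + sineSum q.1 x ^ 2 + 3 * sineSum q.2 x ^ 2)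
        * Real.sin (((j : ℝ) + 1) * x),
   fun j => ((j : ℝ) + 1) ^ 2 * q.2 j + 12 / Real.pi * ∫ x in (0 : ℝ)..Real.pi,
      sineSum q.2 x * (1 + 3 * sineSum q.1 x ^ 2 + sineSum q.2 x ^ 2)
        * Real.sin (((j : ℝ) + 1) * x))

/-- The total energy of the `m`-mode projected system at position `q = (Y, Z)` and
velocity `v = (Y', Z')`. -/
noncomputable def energy (m : ℕ) (q v : Coeffs m) : ℝ :=
  (∑ j, v.1 j ^ 2) / 2 + (∑ j, v.2 j ^ 2) / 6
    + 1 / 2 * ∑ j : Fin m, ((j : ℝ) + 1) ^ 4 * q.1 j ^ 2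
    + 1 / 6 * ∑ j : Fin m, ((j : ℝ) + 1) ^ 2 * q.2 j ^ 2
    + 2 / Real.pi * ∫ x in (0 : ℝ)..Real.pi,
        (sineSum q.1 x ^ 4 / 2 + sineSum q.2 x ^ 4 / 2
          + 3 * sineSum q.1 x ^ 2 * sineSum q.2 x ^ 2
          + sineSum q.1 x ^ 2 + sineSum q.2 x ^ 2)

/-- `u` solves `u'' + G t u = 0` on the time interval `[0, ∞)`, and `v` is its velocity `u'`
(derivatives are one-sided at `t = 0`). -/
def IsSolution {E : Type*} [NormedAddCommGroup E] [NormedSpace ℝ E]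
    (G : ℝ → E → E) (u v : ℝ → E) : Prop :=
  ∀ t, 0 ≤ t → HasDerivWithinAt u (v t) (Ici 0) t ∧
    HasDerivWithinAt v (-(G t (u t))) (Ici 0) t

/-- `Y` is the vertical mode with index `k` and initial data `(α, β) ≠ (0, 0)`: the pair
`(Y, 0)` solves the `m`-mode projected system, with `Y(0) = α e_k` and `Y'(0) = β e_k`. -/
def IsVerticalMode (m : ℕ) (k : Fin m) (α β : ℝ) (Y : ℝ → Fin m → ℝ) : Prop :=
  (α, β) ≠ (0, 0) ∧ ∃ Y' : ℝ → Fin m → ℝ,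
    IsSolution (fun _ => force m)
      (fun t => ((Y t, 0) : Coeffs m)) (fun t => ((Y' t, 0) : Coeffs m)) ∧
    Y 0 = Pi.single k α ∧ Y' 0 = Pi.single k β

/-- The energy `E_k(α, β)` of the vertical mode with index `k` and initial data `(α, β)`: the
conserved energy of the projected system, evaluated on the initial data. -/
noncomputable def modeEnergy (m : ℕ) (k : Fin m) (α β : ℝ) : ℝ :=
  energy m (Pi.single k α, 0) (Pi.single k β, 0)

/-- The norm `‖f‖_∞ = sup_{t ≥ 0} |f t|`, with value `∞` if `f` is unbounded. -/
noncomputable def supNorm (f : ℝ → ℝ) : ℝ≥0∞ := ⨆ t ∈ Ici (0 : ℝ), ENNReal.ofReal |f t|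

/-- The matrix `P` of the torsional components of the linearization of the projected system at
`(Y, 0)`: the derivatives there of the torsional force with respect to the torsional variables.
(The torsional force vanishes for `Z = 0`, so its derivatives with respect to the vertical
variables vanish at `(Y, 0)` and the torsional components of the linearized system decouple from
the vertical ones.) -/
noncomputable def torsionalMatrix (m : ℕ) (Y : Fin m → ℝ) : Matrix (Fin m) (Fin m) ℝ :=
  Matrix.of fun i j => (fderiv ℝ (force m) (Y, 0) (0, Pi.single j 1)).2 i

/-- Lyapunov stability on `[0, ∞)` of the trivial solution of the linear system
`Ξ'' + P(t) Ξ = 0`. -/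
def TrivialSolutionStable {m : ℕ} (P : ℝ → Matrix (Fin m) (Fin m) ℝ) : Prop :=
  ∀ ε > 0, ∃ δ > 0, ∀ ξ ξ' : ℝ → Fin m → ℝ,
    IsSolution (fun t x => (P t).mulVec x) ξ ξ' → ‖ξ 0‖ < δ → ‖ξ' 0‖ < δ →
      ∀ t, 0 ≤ t → ‖ξ t‖ < ε ∧ ‖ξ' t‖ < ε

/-- Torsional stability of the vertical mode `Y`: the trivial solution of the system of the
torsional components of the linearization around `(Y, 0)` is stable. -/
def IsTorsionallyStable (m : ℕ) (Y : ℝ → Fin m → ℝ) : Prop :=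
  TrivialSolutionStable fun t => torsionalMatrix m (Y t)

end FishBone

/-!
For two modes the force field is a polynomial, because the integrals of the quadratic and quartic
monomials in `sin x`, `sin 2x` are explicit (`force_two`). Each vertical component satisfies a linear
equation in itself with a continuous coefficient, so the component that starts at rest at `0` stays
there (`eq_zero_of_linear`), and the other one solves a Duffing equation `y'' + c y + 3/2 y³ = 0` with
`c = 3` or `c = 18`. When one component vanishes the torsional matrix is diagonal, hence the
torsional system splits into two Hill equations `ξ'' + (a + b y²) ξ = 0`.

If `A` is the amplitude, energy conservation factors as
`(y')² = (A² - y²) (c + 3/4 (A² + y²))`, so that `y = A sin φ` with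
`φ' = √(c + 3/4 (A² + y²))` (`exists_duffing_phase`). This shows that `A` is the supremum of `|y|`, is an
increasing function of the energy, and that `y²` has a period `T` with
`√(c + 3/4 A²) T < π < √(c + 3/2 A²) T` (`exists_duffing_period`).

Stability is a criterion of Zhukovskii type (`hill_bounded`). If `m ≤ p ≤ M`, the phase point
`(√M ξ, ξ')` turns with a speed in `[m / √M, √M]`. When the turn over a period lies strictly between
`N π` and `(N + 1) π`, the Wronskian of `ξ` and its translate by `T`, a constant of motion, is in
absolute value comparable to `M ξ² + (ξ')²`. This avoids Floquet multipliers and the existence theory of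
linear equations. It applies with `N = 1` for the first mode and with
`N = 0` for the second. In both cases the binding condition is `√M T < (N + 1) π` for the second
Hill equation, and the amplitude bound is exactly the one under which the estimate of `T` gives it.
-/

namespace FishBone

/-! ### Calculus on the half-line -/

lemma eq_of_hasDerivWithinAt_zero {f f' : ℝ → ℝ}
    (hf : ∀ t, 0 ≤ t → HasDerivWithinAt f (f' t) (Ici 0) t) (h0 : ∀ t, 0 ≤ t → f' t = 0)
    {t : ℝ} (ht : 0 ≤ t) : f t = f 0 := by
  have hc : ContinuousOn f (Ici 0) := fun x hx => (hf x hx).continuousWithinAt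
  have hd : ∀ x ∈ interior (Ici (0 : ℝ)),
      HasDerivWithinAt f (f' x) (interior (Ici 0)) x := fun x hx =>
    (hf x (interior_subset hx)).mono interior_subset
  apply le_antisymm
  · exact antitoneOn_of_hasDerivWithinAt_nonpos (convex_Ici 0) hc hd
      (fun x hx => (h0 x (interior_subset hx)).le) self_mem_Ici ht ht
  · exact monotoneOn_of_hasDerivWithinAt_nonneg (convex_Ici 0) hc hd
      (fun x hx => (h0 x (interior_subset hx)).ge) self_mem_Ici ht ht

lemma mul_le_sub_of_le_hasDerivWithinAt {f f' : ℝ → ℝ} {k : ℝ}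
    (hf : ∀ t, 0 ≤ t → HasDerivWithinAt f (f' t) (Ici 0) t) (hk : ∀ t, 0 ≤ t → k ≤ f' t)
    {s t : ℝ} (hs : 0 ≤ s) (hst : s ≤ t) : k * (t - s) ≤ f t - f s := by
  have hd : ∀ x, 0 ≤ x → HasDerivWithinAt (fun x => f x - k * x) (f' x - k) (Ici 0) x := by
    intro x hx
    exact ((hf x hx).sub ((hasDerivWithinAt_id x (Ici 0)).const_mul k)).congr_deriv (by simp)
  have := monotoneOn_of_hasDerivWithinAt_nonneg (convex_Ici 0)
    (fun x hx => (hd x hx).continuousWithinAt)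
    (fun x hx => (hd x (interior_subset hx)).mono interior_subset)
    (fun x hx => sub_nonneg.2 (hk x (interior_subset hx))) hs (hs.trans hst) hst
  simp only at this
  linarith

lemma sub_le_mul_of_hasDerivWithinAt_le {f f' : ℝ → ℝ} {k : ℝ}
    (hf : ∀ t, 0 ≤ t → HasDerivWithinAt f (f' t) (Ici 0) t) (hk : ∀ t, 0 ≤ t → f' t ≤ k)
    {s t : ℝ} (hs : 0 ≤ s) (hst : s ≤ t) : f t - f s ≤ k * (t - s) := by
  have := mul_le_sub_of_le_hasDerivWithinAt (f := fun x => -f x) (k := -k)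
    (fun x hx => (hf x hx).neg) (fun x hx => neg_le_neg (hk x hx)) hs hst
  linarith

lemma exists_antideriv_Ici {f : ℝ → ℝ} (hf : ContinuousOn f (Ici 0)) (c : ℝ) :
    ∃ F : ℝ → ℝ, F 0 = c ∧ ∀ t, 0 ≤ t → HasDerivWithinAt F (f t) (Ici 0) t := by
  have hg : Continuous fun t : ℝ => f (max t 0) :=
    hf.comp_continuous (by fun_prop) fun t => le_max_right t 0
  refine ⟨fun t => c + ∫ s in (0 : ℝ)..t, f (max s 0), by simp, fun t ht => ?_⟩
  have := (hg.integral_hasStrictDerivAt 0 t).hasDerivAt.const_add c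
  simpa [max_eq_left ht] using this.hasDerivWithinAt

/-- Two-sided Grönwall estimate on an interval `[0, b]`. -/
lemma gronwall_two_sided {f f' : ℝ → ℝ} {K b : ℝ}
    (hf : ∀ t, 0 ≤ t → HasDerivWithinAt f (f' t) (Ici 0) t)
    (hK : ∀ t, 0 ≤ t → t ≤ b → |f' t| ≤ K * f t) {s t : ℝ} (hs : 0 ≤ s) (hst : s ≤ t)
    (htb : t ≤ b) :
    f s * Real.exp (-(K * (t - s))) ≤ f t ∧ f t ≤ f s * Real.exp (K * (t - s)) := by
  have hd : ∀ L x, 0 ≤ x → HasDerivWithinAt (fun x => f x * Real.exp (L * x))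
      ((f' x + L * f x) * Real.exp (L * x)) (Ici 0) x := by
    intro L x hx
    have h1 : HasDerivWithinAt (fun x : ℝ => Real.exp (L * x)) (Real.exp (L * x) * (L * 1))
      (Ici 0) x := ((hasDerivAt_id x).const_mul L).exp.hasDerivWithinAt
    exact ((hf x hx).mul h1).congr_deriv (by ring)
  have hI : ∀ {x}, x ∈ Icc (0 : ℝ) b → 0 ≤ x := fun hx => hx.1
  have hsub : interior (Icc (0 : ℝ) b) ⊆ Ici 0 := fun x hx => (interior_subset hx).1
  have hs' : s ∈ Icc 0 b := ⟨hs, hst.trans htb⟩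
  have ht' : t ∈ Icc 0 b := ⟨hs.trans hst, htb⟩
  constructor
  · have := monotoneOn_of_hasDerivWithinAt_nonneg (convex_Icc 0 b)
      (fun x hx => (hd K x hx.1).continuousWithinAt.mono Icc_subset_Ici_self)
      (fun x hx => (hd K x (interior_subset hx).1).mono hsub)
      (fun x hx => mul_nonneg (by
        have := abs_le.1 (hK x (interior_subset hx).1 (interior_subset hx).2)
        linarith) (Real.exp_pos _).le) hs' ht' hst
    simp only at this
    rw [show -(K * (t - s)) = K * s - K * t by ring, Real.exp_sub, ← mul_div_assoc,
      div_le_iff₀ (Real.exp_pos _)]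
    exact this
  · have := antitoneOn_of_hasDerivWithinAt_nonpos (convex_Icc 0 b)
      (fun x hx => (hd (-K) x hx.1).continuousWithinAt.mono Icc_subset_Ici_self)
      (fun x hx => (hd (-K) x (interior_subset hx).1).mono hsub)
      (fun x hx => mul_nonpos_of_nonpos_of_nonneg (by
        have := abs_le.1 (hK x (interior_subset hx).1 (interior_subset hx).2)
        linarith) (Real.exp_pos _).le) hs' ht' hst
    simp only [neg_mul, Real.exp_neg, ← div_eq_mul_inv] at this
    rw [div_le_div_iff₀ (Real.exp_pos _) (Real.exp_pos _)] at this
    rw [mul_sub, Real.exp_sub, ← mul_div_assoc, le_div_iff₀ (Real.exp_pos _)]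
    exact this

/-- A solution of the linear rotation equation `u' = ω w`, `w' = -ω u` on the unit circle has
a differentiable angle, with derivative `ω`. -/
lemma exists_angle {u w ω : ℝ → ℝ} (hω : ContinuousOn ω (Ici 0))
    (hu : ∀ t, 0 ≤ t → HasDerivWithinAt u (ω t * w t) (Ici 0) t)
    (hw : ∀ t, 0 ≤ t → HasDerivWithinAt w (-(ω t * u t)) (Ici 0) t)
    (h0 : u 0 ^ 2 + w 0 ^ 2 = 1) :
    ∃ θ : ℝ → ℝ, (∀ t, 0 ≤ t → HasDerivWithinAt θ (ω t) (Ici 0) t) ∧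
      ∀ t, 0 ≤ t → u t = Real.sin (θ t) ∧ w t = Real.cos (θ t) := by
  have hz : ‖(⟨w 0, u 0⟩ : ℂ)‖ = 1 := by
    rw [← sq_eq_sq₀ (norm_nonneg _) zero_le_one, Complex.sq_norm, Complex.normSq_apply]
    simp only; linarith
  have hz0 : (⟨w 0, u 0⟩ : ℂ) ≠ 0 := by
    rw [← norm_ne_zero_iff, hz]; exact one_ne_zero
  obtain ⟨θ, hθ0, hθ⟩ := exists_antideriv_Ici hω (Complex.arg ⟨w 0, u 0⟩)
  refine ⟨θ, hθ, fun t ht => ?_⟩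
  have hd : ∀ t, 0 ≤ t → HasDerivWithinAt
      (fun t => (u t - Real.sin (θ t)) ^ 2 + (w t - Real.cos (θ t)) ^ 2) 0 (Ici 0) t := by
    intro t ht
    have h1 := ((hu t ht).sub (hθ t ht).sin).pow 2
    have h2 := ((hw t ht).sub (hθ t ht).cos).pow 2
    exact (h1.add h2).congr_deriv (by simp; ring)
  have hc := eq_of_hasDerivWithinAt_zero hd (fun _ _ => rfl) ht
  have hs0 : Real.sin (θ 0) = u 0 := by rw [hθ0, Complex.sin_arg, hz]; simp
  have hc0 : Real.cos (θ 0) = w 0 := by rw [hθ0, Complex.cos_arg hz0, hz]; simp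
  simp only [hs0, hc0, sub_self] at hc
  constructor <;> nlinarith [sq_nonneg (u t - Real.sin (θ t)), sq_nonneg (w t - Real.cos (θ t))]

/-- A solution of `y'' + c(t) y = 0` with zero initial data vanishes. -/
lemma eq_zero_of_linear {y v c : ℝ → ℝ} (hc : ContinuousOn c (Ici 0))
    (hy : ∀ t, 0 ≤ t → HasDerivWithinAt y (v t) (Ici 0) t)
    (hv : ∀ t, 0 ≤ t → HasDerivWithinAt v (-(c t * y t)) (Ici 0) t)
    (hy0 : y 0 = 0) (hv0 : v 0 = 0) {t : ℝ} (ht : 0 ≤ t) : y t = 0 := by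
  obtain ⟨C, hC⟩ := isCompact_Icc.exists_bound_of_continuousOn
    (hc.mono (Icc_subset_Ici_self : Icc 0 t ⊆ Ici 0))
  have hd : ∀ s, 0 ≤ s → HasDerivWithinAt (fun s => y s ^ 2 + v s ^ 2)
      (2 * (1 - c s) * (y s * v s)) (Ici 0) s := fun s hs =>
    (((hy s hs).pow 2).add ((hv s hs).pow 2)).congr_deriv (by simp; ring)
  have h := (gronwall_two_sided hd (K := 1 + C) (b := t) (fun s hs hst => ?_) le_rfl ht le_rfl).2
  · simp only [hy0, hv0] at h
    nlinarith [sq_nonneg (v t), sq_nonneg (y t)]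
  · have h1 : |1 - c s| ≤ 1 + C := (abs_sub _ _).trans (by
      have := hC s ⟨hs, hst⟩
      rw [Real.norm_eq_abs] at this
      simpa using this)
    have h2 : 2 * |y s * v s| ≤ y s ^ 2 + v s ^ 2 := by
      rw [abs_mul, ← sq_abs (y s), ← sq_abs (v s)]
      nlinarith [sq_nonneg (|y s| - |v s|)]
    rw [abs_mul, abs_mul, abs_two]
    nlinarith [abs_nonneg (1 - c s), abs_nonneg (y s * v s), sq_nonneg (v s), sq_nonneg (y s)]

/-! ### The two-mode system in closed form -/

/-- The integrals over `[0, π]` of all quadratic and quartic monomials in `sin x`, `sin (2 x)`,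
collected into one formula. -/
lemma integral_sine_quartic (a₀ a₁ a₂ b₀ b₁ b₂ b₃ b₄ : ℝ) :
    ∫ x in (0 : ℝ)..Real.pi,
      (a₀ * Real.sin x ^ 2 + a₁ * (Real.sin x * Real.sin (2 * x)) + a₂ * Real.sin (2 * x) ^ 2
        + b₀ * Real.sin x ^ 4 + b₁ * (Real.sin x ^ 3 * Real.sin (2 * x))
        + b₂ * (Real.sin x ^ 2 * Real.sin (2 * x) ^ 2)
        + b₃ * (Real.sin x * Real.sin (2 * x) ^ 3) + b₄ * Real.sin (2 * x) ^ 4)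
      = Real.pi / 2 * (a₀ + a₂) + 3 * Real.pi / 8 * (b₀ + b₄) + Real.pi / 4 * b₂ := by
  -- With `s = sin x`, `c = cos x` every summand is a polynomial in `s`, `c`; the primitive is
  -- linear in `x` up to a polynomial divisible by `s`.
  have hI : ∀ (k : ℕ) x, HasDerivAt (fun x => Real.sin x ^ k) (k * Real.sin x ^ (k - 1) *
      Real.cos x) x := fun k x => (Real.hasDerivAt_sin x).pow k
  have hJ : ∀ (k : ℕ) x, HasDerivAt (fun x => Real.sin x ^ k * Real.cos x)
      (k * Real.sin x ^ (k - 1) * Real.cos x * Real.cos x + Real.sin x ^ k * -Real.sin x) x :=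
    fun k x => (hI k x).mul (Real.hasDerivAt_cos x)
  obtain ⟨C₂, hC₂⟩ : ∃ C, C = a₀ + 4 * a₂ := ⟨_, rfl⟩
  obtain ⟨C₄, hC₄⟩ : ∃ C, C = -4 * a₂ + b₀ + 4 * b₂ + 16 * b₄ := ⟨_, rfl⟩
  obtain ⟨C₆, hC₆⟩ : ∃ C, C = -4 * b₂ - 32 * b₄ := ⟨_, rfl⟩
  obtain ⟨C₈, hC₈⟩ : ∃ C, C = 16 * b₄ := ⟨_, rfl⟩
  have key : ∀ x, HasDerivAt (fun x =>
      (C₂ / 2 + 3 / 8 * C₄ + 5 / 16 * C₆ + 35 / 128 * C₈) * x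
      + -(C₂ / 2 + 3 / 8 * C₄ + 5 / 16 * C₆ + 35 / 128 * C₈) * (Real.sin x ^ 1 * Real.cos x)
      + -(C₄ / 4 + 5 / 24 * C₆ + 35 / 192 * C₈) * (Real.sin x ^ 3 * Real.cos x)
      + -(C₆ / 6 + 7 / 48 * C₈) * (Real.sin x ^ 5 * Real.cos x)
      + -(C₈ / 8) * (Real.sin x ^ 7 * Real.cos x)
      + 2 * a₁ / 3 * Real.sin x ^ 3 + (2 * b₁ / 5 + 8 * b₃ / 5) * Real.sin x ^ 5
      + -(8 * b₃ / 7) * Real.sin x ^ 7)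
      (a₀ * Real.sin x ^ 2 + a₁ * (Real.sin x * Real.sin (2 * x)) + a₂ * Real.sin (2 * x) ^ 2
        + b₀ * Real.sin x ^ 4 + b₁ * (Real.sin x ^ 3 * Real.sin (2 * x))
        + b₂ * (Real.sin x ^ 2 * Real.sin (2 * x) ^ 2)
        + b₃ * (Real.sin x * Real.sin (2 * x) ^ 3) + b₄ * Real.sin (2 * x) ^ 4) x := by
    intro x
    have e2 : Real.cos x ^ 2 = 1 - Real.sin x ^ 2 := Real.cos_sq' x
    have e3 : Real.cos x ^ 3 = Real.cos x * (1 - Real.sin x ^ 2) := by rw [← e2]; ring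
    have e4 : Real.cos x ^ 4 = (1 - Real.sin x ^ 2) ^ 2 := by rw [← e2]; ring
    refine ((((((((hasDerivAt_id x).const_mul _).add ((hJ 1 x).const_mul _)).add
      ((hJ 3 x).const_mul _)).add ((hJ 5 x).const_mul _)).add ((hJ 7 x).const_mul _)).add
      ((hI 3 x).const_mul _)).add ((hI 5 x).const_mul _)).add
      ((hI 7 x).const_mul _) |>.congr_deriv ?_
    rw [Real.sin_two_mul, hC₂, hC₄, hC₆, hC₈]
    norm_num
    ring_nf
    rw [e2, e3, e4]
    ring
  rw [intervalIntegral.integral_eq_sub_of_hasDerivAt (fun x _ => key x)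
    (Continuous.intervalIntegrable (by fun_prop) _ _)]
  simp [hC₂, hC₄, hC₆, hC₈]
  ring

lemma sineSum_two (c : Fin 2 → ℝ) (x : ℝ) :
    sineSum c x = c 0 * Real.sin x + c 1 * Real.sin (2 * x) := by
  simp only [sineSum, Fin.sum_univ_two]
  norm_num

/-- The force field of the two-mode system as a polynomial map. -/
lemma force_two (q : Coeffs 2) : force 2 q =
    (![3 * q.1 0 + 3 / 2 * q.1 0 ^ 3 + 3 * q.1 0 * q.1 1 ^ 2
          + 9 / 2 * (q.1 0 * q.2 0 ^ 2)
            + 3 * (q.1 0 * q.2 1 ^ 2 + 2 * q.1 1 * q.2 0 * q.2 1),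
        18 * q.1 1 + 3 / 2 * q.1 1 ^ 3 + 3 * q.1 1 * q.1 0 ^ 2
          + 9 / 2 * (q.1 1 * q.2 1 ^ 2)
            + 3 * (q.1 1 * q.2 0 ^ 2 + 2 * q.1 0 * q.2 0 * q.2 1)],
     ![7 * q.2 0 + 9 / 2 * q.2 0 ^ 3 + 9 * q.2 0 * q.2 1 ^ 2
          + 27 / 2 * (q.1 0 ^ 2 * q.2 0) + 9 * (q.1 1 ^ 2 * q.2 0 + 2 * q.1 0 * q.1 1 * q.2 1),
       10 * q.2 1 + 9 / 2 * q.2 1 ^ 3 + 9 * q.2 1 * q.2 0 ^ 2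
          + 27 / 2 * (q.1 1 ^ 2 * q.2 1)
          + 9 * (q.1 0 ^ 2 * q.2 1 + 2 * q.1 0 * q.1 1 * q.2 0)]) := by
  obtain ⟨y, z⟩ := q
  have hπ := Real.pi_ne_zero
  -- Shared expansion: `f (1 + f² + 3 g²) sin (j x)` is a combination of the monomials
  -- integrated above.
  have h0 : ∀ (f g : Fin 2 → ℝ), ∫ x in (0 : ℝ)..Real.pi,
      sineSum f x * (1 + sineSum f x ^ 2 + 3 * sineSum g x ^ 2) * Real.sin x =
      Real.pi / 2 * f 0 + 3 * Real.pi / 8 * (f 0 ^ 3 + 3 * f 0 * g 0 ^ 2)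
        + Real.pi / 4 * (3 * f 0 * f 1 ^ 2 + 3 * (f 0 * g 1 ^ 2 + 2 * f 1 * g 0 * g 1)) := by
    intro f g
    have := integral_sine_quartic (f 0) (f 1) 0 (f 0 ^ 3 + 3 * f 0 * g 0 ^ 2)
      (3 * f 0 ^ 2 * f 1 + 3 * (2 * f 0 * g 0 * g 1 + f 1 * g 0 ^ 2))
      (3 * f 0 * f 1 ^ 2 + 3 * (f 0 * g 1 ^ 2 + 2 * f 1 * g 0 * g 1))
      (f 1 ^ 3 + 3 * f 1 * g 1 ^ 2) 0
    rw [add_zero, add_zero] at this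
    rw [← this]
    refine intervalIntegral.integral_congr fun x _ => ?_
    simp only [sineSum_two]
    ring
  have h1 : ∀ (f g : Fin 2 → ℝ), ∫ x in (0 : ℝ)..Real.pi,
      sineSum f x * (1 + sineSum f x ^ 2 + 3 * sineSum g x ^ 2) * Real.sin (2 * x) =
      Real.pi / 2 * f 1 + 3 * Real.pi / 8 * (f 1 ^ 3 + 3 * f 1 * g 1 ^ 2)
        + Real.pi / 4 * (3 * f 1 * f 0 ^ 2 + 3 * (f 1 * g 0 ^ 2 + 2 * f 0 * g 0 * g 1)) := by
    intro f g
    have := integral_sine_quartic 0 (f 0) (f 1) 0 (f 0 ^ 3 + 3 * f 0 * g 0 ^ 2)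
      (3 * f 0 ^ 2 * f 1 + 3 * (2 * f 0 * g 0 * g 1 + f 1 * g 0 ^ 2))
      (3 * f 0 * f 1 ^ 2 + 3 * (f 0 * g 1 ^ 2 + 2 * f 1 * g 0 * g 1))
      (f 1 ^ 3 + 3 * f 1 * g 1 ^ 2)
    rw [zero_add, zero_add] at this
    rw [show 3 * f 1 * f 0 ^ 2 + 3 * (f 1 * g 0 ^ 2 + 2 * f 0 * g 0 * g 1) =
      3 * f 0 ^ 2 * f 1 + 3 * (2 * f 0 * g 0 * g 1 + f 1 * g 0 ^ 2) by ring, ← this]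
    refine intervalIntegral.integral_congr fun x _ => ?_
    simp only [sineSum_two]
    ring
  have e : ∀ x, sineSum z x * (1 + 3 * sineSum y x ^ 2 + sineSum z x ^ 2) =
      sineSum z x * (1 + sineSum z x ^ 2 + 3 * sineSum y x ^ 2) := fun x => by ring
  ext j <;> fin_cases j <;>
    norm_num [force, e, h0, h1] <;> field_simp <;> ring

lemma integral_energy_single (k : Fin 2) (α : ℝ) :
    ∫ x in (0 : ℝ)..Real.pi, (sineSum (Pi.single k α : Fin 2 → ℝ) x ^ 4 / 2
      + sineSum (Pi.single k α : Fin 2 → ℝ) x ^ 2)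
      = Real.pi / 2 * α ^ 2 + 3 * Real.pi / 16 * α ^ 4 := by
  fin_cases k
  · have := integral_sine_quartic (α ^ 2) 0 0 (α ^ 4 / 2) 0 0 0 0
    refine Eq.trans (intervalIntegral.integral_congr fun x _ => ?_) (this.trans (by ring))
    simp [sineSum_two]
    ring
  · have := integral_sine_quartic 0 0 (α ^ 2) 0 0 0 0 (α ^ 4 / 2)
    refine Eq.trans (intervalIntegral.integral_congr fun x _ => ?_) (this.trans (by ring))
    simp [sineSum_two]
    ring

lemma modeEnergy_two_zero (α β : ℝ) :
    modeEnergy 2 0 α β = β ^ 2 / 2 + 3 / 2 * α ^ 2 + 3 / 8 * α ^ 4 := by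
  have hz : ∀ x, sineSum (0 : Fin 2 → ℝ) x = 0 := fun x => by simp [sineSum]
  have := integral_energy_single 0 α
  simp [modeEnergy, energy, hz, this]
  field_simp
  ring

lemma modeEnergy_two_one (α β : ℝ) :
    modeEnergy 2 1 α β = β ^ 2 / 2 + 18 / 2 * α ^ 2 + 3 / 8 * α ^ 4 := by
  have hz : ∀ x, sineSum (0 : Fin 2 → ℝ) x = 0 := fun x => by simp [sineSum]
  have := integral_energy_single 1 α
  norm_num [modeEnergy, energy, hz, this]
  field_simp
  ring

lemma torsionalMatrix_two (Y : Fin 2 → ℝ) : torsionalMatrix 2 Y =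
    !![7 + 27 / 2 * Y 0 ^ 2 + 9 * Y 1 ^ 2, 18 * Y 0 * Y 1;
       18 * Y 0 * Y 1, 10 + 27 / 2 * Y 1 ^ 2 + 9 * Y 0 ^ 2] := by
  have hd : DifferentiableAt ℝ (force 2) (Y, 0) := by
    rw [funext force_two]
    refine DifferentiableAt.prodMk (differentiableAt_pi.2 fun i => ?_)
      (differentiableAt_pi.2 fun i => ?_) <;> fin_cases i <;> simp <;> fun_prop
  -- The entries are derivatives of the torsional force along the lines through `(Y, 0)`.
  have hl : ∀ (i j : Fin 2) (d : ℝ), HasDerivAt (fun s : ℝ =>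
      (force 2 (Y, s • Pi.single j 1)).2 i) d 0 → torsionalMatrix 2 Y i j = d := by
    intro i j d h
    have h1 : HasDerivAt (fun s : ℝ => ((Y, s • Pi.single j 1) : Coeffs 2))
        (0, Pi.single j 1) 0 := by
      have := (hasDerivAt_id (0 : ℝ)).smul_const (Pi.single j 1 : Fin 2 → ℝ)
      simpa using (hasDerivAt_const (0 : ℝ) Y).prodMk this
    have h2 : HasFDerivAt (force 2) (fderiv ℝ (force 2) (Y, 0))
        ((fun s : ℝ => ((Y, s • Pi.single j 1) : Coeffs 2)) 0) := by
      simpa using hd.hasFDerivAt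
    have h3 := hasDerivAt_pi.1 (h2.comp_hasDerivAt 0 h1).hasFDerivAt.snd.hasDerivAt i
    simpa [torsionalMatrix] using h3.unique h
  have hp : ∀ a b c : ℝ, HasDerivAt (fun s : ℝ => a * s + b * s ^ 2 + c * s ^ 3) a 0 := by
    intro a b c
    have := (((hasDerivAt_id (0 : ℝ)).const_mul a).add ((hasDerivAt_pow 2 (0 : ℝ)).const_mul b)).add
      ((hasDerivAt_pow 3 (0 : ℝ)).const_mul c)
    exact this.congr_deriv (by simp)
  ext i j
  fin_cases i <;> fin_cases j
  · refine hl 0 0 _ ((hp _ 0 (9 / 2)).congr_of_eventuallyEq (.of_forall fun s => ?_))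
    simp [force_two]; ring
  · refine hl 0 1 _ ((hp _ 0 0).congr_of_eventuallyEq (.of_forall fun s => ?_))
    simp [force_two]; ring
  · refine hl 1 0 _ ((hp _ 0 0).congr_of_eventuallyEq (.of_forall fun s => ?_))
    simp [force_two]; ring
  · refine hl 1 1 _ ((hp _ 0 (9 / 2)).congr_of_eventuallyEq (.of_forall fun s => ?_))
    simp [force_two]; ring

/-! ### The Duffing equation of a single vertical mode -/

lemma duffing_energy {c E : ℝ} {y v : ℝ → ℝ}
    (hy : ∀ t, 0 ≤ t → HasDerivWithinAt y (v t) (Ici 0) t)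
    (hv : ∀ t, 0 ≤ t → HasDerivWithinAt v (-(c * y t + 3 / 2 * y t ^ 3)) (Ici 0) t)
    (hE : v 0 ^ 2 / 2 + c / 2 * y 0 ^ 2 + 3 / 8 * y 0 ^ 4 = E) {t : ℝ} (ht : 0 ≤ t) :
    v t ^ 2 / 2 + c / 2 * y t ^ 2 + 3 / 8 * y t ^ 4 = E := by
  have hd : ∀ t, 0 ≤ t → HasDerivWithinAt
      (fun t => v t ^ 2 / 2 + c / 2 * y t ^ 2 + 3 / 8 * y t ^ 4) 0 (Ici 0) t := fun t ht =>
    (((((hv t ht).pow 2).div_const 2).add (((hy t ht).pow 2).const_mul (c / 2))).add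
      (((hy t ht).pow 4).const_mul (3 / 8))).congr_deriv (by simp; ring)
  rw [← hE]
  exact eq_of_hasDerivWithinAt_zero hd (fun _ _ => rfl) ht

lemma exists_duffing_amplitude {c E : ℝ} (hc : 0 < c) (hE : 0 < E) :
    ∃ A : ℝ, 0 < A ∧ c / 2 * A ^ 2 + 3 / 8 * A ^ 4 = E := by
  have h1 : 2 * c < Real.sqrt (4 * c ^ 2 + 24 * E) :=
    Real.lt_sqrt_of_sq_lt (by linarith)
  have h2 := Real.sq_sqrt (show 0 ≤ 4 * c ^ 2 + 24 * E by positivity)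
  have h3 : 0 < (Real.sqrt (4 * c ^ 2 + 24 * E) - 2 * c) / 3 := by linarith
  refine ⟨Real.sqrt ((Real.sqrt (4 * c ^ 2 + 24 * E) - 2 * c) / 3), Real.sqrt_pos.2 h3, ?_⟩
  rw [show ∀ x : ℝ, x ^ 4 = (x ^ 2) ^ 2 from fun x => by ring, Real.sq_sqrt h3.le]
  linear_combination h2 / 24

lemma hasDerivAt_sqrt_speed {c a z : ℝ} (hc : 0 < c) (ha : 0 ≤ a) :
    HasDerivAt (fun z => Real.sqrt (c + 3 / 4 * (a + z ^ 2)))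
      (3 / 4 * z / Real.sqrt (c + 3 / 4 * (a + z ^ 2))) z := by
  have hpos : 0 < c + 3 / 4 * (a + z ^ 2) := by positivity
  have h := ((((hasDerivAt_pow 2 z).const_add a).const_mul (3 / 4)).const_add c).sqrt hpos.ne'
  exact h.congr_deriv (by
    have := (Real.sqrt_pos.2 hpos).ne'
    push_cast
    field_simp)

/-- Action-angle form of the Duffing equation: `y = A sin φ`, where the phase `φ` moves with the
speed `√(c + 3/4 (A² + y²))`, the factor left over when `(y')²` is divided by `A² - y²`. -/
lemma exists_duffing_phase {c A : ℝ} (hc : 0 < c) (hA : 0 < A) {y v : ℝ → ℝ}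
    (hy : ∀ t, 0 ≤ t → HasDerivWithinAt y (v t) (Ici 0) t)
    (hv : ∀ t, 0 ≤ t → HasDerivWithinAt v (-(c * y t + 3 / 2 * y t ^ 3)) (Ici 0) t)
    (hE : v 0 ^ 2 / 2 + c / 2 * y 0 ^ 2 + 3 / 8 * y 0 ^ 4 = c / 2 * A ^ 2 + 3 / 8 * A ^ 4) :
    ∃ φ : ℝ → ℝ, (∀ t, 0 ≤ t → HasDerivWithinAt φ
        (Real.sqrt (c + 3 / 4 * (A ^ 2 + (A * Real.sin (φ t)) ^ 2))) (Ici 0) t) ∧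
      ∀ t, 0 ≤ t → y t = A * Real.sin (φ t) := by
  set g : ℝ → ℝ := fun z => Real.sqrt (c + 3 / 4 * (A ^ 2 + z ^ 2)) with hg
  have hgpos : ∀ z, 0 < g z := fun z => Real.sqrt_pos.2 (by positivity)
  have hgsq : ∀ z, g z ^ 2 = c + 3 / 4 * (A ^ 2 + z ^ 2) := fun z => Real.sq_sqrt (by positivity)
  have hv2 : ∀ t, 0 ≤ t → v t ^ 2 = (A ^ 2 - y t ^ 2) * g (y t) ^ 2 := fun t ht => by
    rw [hgsq]
    linear_combination 2 * duffing_energy hy hv hE ht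
  have hyc : ContinuousOn y (Ici 0) := fun t ht => (hy t ht).continuousWithinAt
  have hgc : Continuous g := by fun_prop
  obtain ⟨φ, hφ, hφy⟩ := exists_angle (u := fun t => y t / A) (w := fun t => v t / g (y t) / A)
    (ω := fun t => g (y t)) (hgc.comp_continuousOn hyc)
    (fun t ht => ((hy t ht).div_const A).congr_deriv (by
      have := (hgpos (y t)).ne'
      field_simp))
    (fun t ht => by
      have hgy := (hasDerivAt_sqrt_speed (z := y t) hc (sq_nonneg A)).comp_hasDerivWithinAt t
        (hy t ht)
      refine (((hv t ht).div hgy (hgpos (y t)).ne').div_const A).congr_deriv ?_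
      have h1 := (hgpos (y t)).ne'
      change (-(c * y t + 3 / 2 * y t ^ 3) * g (y t) - v t * (3 / 4 * y t / g (y t) * v t))
        / g (y t) ^ 2 / A = _
      field_simp
      linear_combination (-(6 * y t)) * hv2 t ht + (8 * g (y t) ^ 2 * y t) * hgsq (y t))
    (by
      have h1 := (hgpos (y 0)).ne'
      have h2 := hv2 0 le_rfl
      field_simp
      linear_combination h2)
  have hyφ : ∀ t, 0 ≤ t → y t = A * Real.sin (φ t) := fun t ht => by
    rw [← (hφy t ht).1]
    field_simp
  exact ⟨φ, fun t ht => (hφ t ht).congr_deriv (by rw [hyφ t ht]), hyφ⟩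

/-- The period of `y²`, as an integral over one half-turn of the phase, and its bounds by the
extreme phase speeds. -/
lemma exists_duffing_period {c A : ℝ} (hc : 0 < c) (hA : 0 < A) {φ : ℝ → ℝ}
    (hφ : ∀ t, 0 ≤ t → HasDerivWithinAt φ
        (Real.sqrt (c + 3 / 4 * (A ^ 2 + (A * Real.sin (φ t)) ^ 2))) (Ici 0) t) :
    ∃ T : ℝ, 0 < T ∧ (∀ t, 0 ≤ t → φ (t + T) = φ t + Real.pi) ∧
      Real.sqrt (c + 3 / 4 * A ^ 2) * T < Real.pi ∧
      Real.pi < Real.sqrt (c + 3 / 2 * A ^ 2) * T := by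
  set g : ℝ → ℝ := fun x => Real.sqrt (c + 3 / 4 * (A ^ 2 + (A * Real.sin x) ^ 2)) with hg
  have hgpos : ∀ x, 0 < g x := fun x => Real.sqrt_pos.2 (by positivity)
  have hgc : Continuous fun x => (g x)⁻¹ :=
    (by fun_prop : Continuous g).inv₀ fun x => (hgpos x).ne'
  have hint : ∀ a b, IntervalIntegrable (fun x => (g x)⁻¹) MeasureTheory.volume a b :=
    fun a b => hgc.intervalIntegrable a b
  -- `G` is the time that the phase needs to move from `0` to `x`.
  set G : ℝ → ℝ := fun x => ∫ s in (0 : ℝ)..x, (g s)⁻¹ with hG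
  have hGd : ∀ x, HasDerivAt G (g x)⁻¹ x := fun x => (hgc.integral_hasStrictDerivAt 0 x).hasDerivAt
  have hGm : StrictMono G := strictMono_of_hasDerivAt_pos hGd fun x => inv_pos.2 (hgpos x)
  have hper : Function.Periodic (fun x => (g x)⁻¹) Real.pi := fun x => by
    simp [hg, Real.sin_add_pi]
  have hGpi : ∀ x, G (x + Real.pi) = G x + G Real.pi := fun x => by
    have h1 := intervalIntegral.integral_add_adjacent_intervals (hint 0 x) (hint x (x + Real.pi))
    have h2 := hper.intervalIntegral_add_eq x 0
    rw [zero_add] at h2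
    simp only [hG]
    rw [← h1, h2]
  have hGt : ∀ t, 0 ≤ t → G (φ t) = t + G (φ 0) := fun t ht => by
    have hd : ∀ t, 0 ≤ t → HasDerivWithinAt (fun t => G (φ t) - t) 0 (Ici 0) t := fun t ht =>
      (((hGd (φ t)).comp_hasDerivWithinAt t (hφ t ht)).sub
        (hasDerivWithinAt_id t (Ici 0))).congr_deriv (by
          change (g (φ t))⁻¹ * g (φ t) - 1 = 0
          rw [inv_mul_cancel₀ (hgpos _).ne', sub_self])
    have := eq_of_hasDerivWithinAt_zero hd (fun _ _ => rfl) ht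
    linarith
  have hT : 0 < G Real.pi := by
    have := hGm Real.pi_pos
    simpa [hG] using this
  have hk0 : 0 < Real.sqrt (c + 3 / 4 * A ^ 2) := Real.sqrt_pos.2 (by positivity)
  have hk1 : 0 < Real.sqrt (c + 3 / 2 * A ^ 2) := Real.sqrt_pos.2 (by positivity)
  have hlt : Real.sqrt (c + 3 / 4 * A ^ 2) < Real.sqrt (c + 3 / 2 * A ^ 2) :=
    Real.sqrt_lt_sqrt (by positivity) (by nlinarith [pow_pos hA 2])
  have hg0 : g 0 = Real.sqrt (c + 3 / 4 * A ^ 2) := by simp [hg]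
  have hg1 : g (Real.pi / 2) = Real.sqrt (c + 3 / 2 * A ^ 2) := by
    simp only [hg, Real.sin_pi_div_two]
    congr 1
    ring
  refine ⟨G Real.pi, hT, fun t ht => hGm.injective ?_, ?_, ?_⟩
  · rw [hGpi, hGt _ (add_nonneg ht hT.le), hGt t ht]
    ring
  · have := intervalIntegral.integral_lt_integral_of_continuousOn_of_le_of_exists_lt
      (f := fun x => (g x)⁻¹) (g := fun _ => (Real.sqrt (c + 3 / 4 * A ^ 2))⁻¹) Real.pi_pos
      hgc.continuousOn continuousOn_const
      (fun x _ => inv_anti₀ hk0 (Real.sqrt_le_sqrt (by nlinarith [sq_nonneg (A * Real.sin x)])))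
      ⟨Real.pi / 2, ⟨by positivity, by linarith [Real.pi_pos]⟩, by
        rw [hg1]; exact inv_strictAnti₀ hk0 hlt⟩
    rw [intervalIntegral.integral_const, smul_eq_mul, sub_zero, ← div_eq_mul_inv,
      lt_div_iff₀ hk0] at this
    rw [mul_comm]
    exact this
  · have := intervalIntegral.integral_lt_integral_of_continuousOn_of_le_of_exists_lt
      (f := fun _ => (Real.sqrt (c + 3 / 2 * A ^ 2))⁻¹) (g := fun x => (g x)⁻¹) Real.pi_pos
      continuousOn_const hgc.continuousOn
      (fun x _ => inv_anti₀ (hgpos x) (Real.sqrt_le_sqrt (by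
        nlinarith [Real.sin_sq_le_one x, sq_nonneg A])))
      ⟨0, ⟨le_rfl, Real.pi_pos.le⟩, by
        rw [hg0]; exact inv_strictAnti₀ hk0 hlt⟩
    rw [intervalIntegral.integral_const, smul_eq_mul, sub_zero, ← div_eq_mul_inv,
      div_lt_iff₀ hk1] at this
    rw [mul_comm]
    exact this

/-- A phase that moves at a speed of at least `k > 0` passes through a maximum of `|sin|`. -/
lemma exists_abs_sin_eq_one {φ φ' : ℝ → ℝ} {k : ℝ} (hk : 0 < k)
    (hφ : ∀ t, 0 ≤ t → HasDerivWithinAt φ (φ' t) (Ici 0) t) (hφ' : ∀ t, 0 ≤ t → k ≤ φ' t) :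
    ∃ t, 0 ≤ t ∧ |Real.sin (φ t)| = 1 := by
  obtain ⟨n, hn⟩ := exists_nat_ge ((φ 0 - Real.pi / 2) / Real.pi)
  rw [div_le_iff₀ Real.pi_pos] at hn
  set x : ℝ := Real.pi / 2 + n * Real.pi with hx
  have hx0 : φ 0 ≤ x := by linarith
  have hb : 0 ≤ (x - φ 0) / k := div_nonneg (by linarith) hk.le
  have h1 := mul_le_sub_of_le_hasDerivWithinAt hφ hφ' le_rfl hb
  rw [sub_zero, mul_div_cancel₀ _ hk.ne'] at h1
  obtain ⟨t, ht, htx⟩ := intermediate_value_Icc hb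
    (fun s hs => ((hφ s hs.1).continuousWithinAt.mono Icc_subset_Ici_self))
    (show x ∈ Icc (φ 0) (φ ((x - φ 0) / k)) from ⟨hx0, by linarith⟩)
  refine ⟨t, ht.1, ?_⟩
  rw [htx, hx, Real.sin_add_nat_mul_pi, abs_mul]
  simp

/-- Amplitude and period of a nontrivial solution of `y'' + c y + 3/2 y³ = 0`; `T` is a period of
`y²`, that is, half a period of `y`. -/
lemma duffing_summary {c : ℝ} (hc : 0 < c) {y v : ℝ → ℝ}
    (hy : ∀ t, 0 ≤ t → HasDerivWithinAt y (v t) (Ici 0) t)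
    (hv : ∀ t, 0 ≤ t → HasDerivWithinAt v (-(c * y t + 3 / 2 * y t ^ 3)) (Ici 0) t)
    (h0 : (y 0, v 0) ≠ (0, 0)) :
    ∃ A T : ℝ, 0 < A ∧ 0 < T ∧
      c / 2 * A ^ 2 + 3 / 8 * A ^ 4 = v 0 ^ 2 / 2 + c / 2 * y 0 ^ 2 + 3 / 8 * y 0 ^ 4 ∧
      supNorm y = ENNReal.ofReal A ∧ (∀ t, 0 ≤ t → y t ^ 2 ≤ A ^ 2) ∧
      (∀ t, 0 ≤ t → y (t + T) ^ 2 = y t ^ 2) ∧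
      Real.sqrt (c + 3 / 4 * A ^ 2) * T < Real.pi ∧
      Real.pi < Real.sqrt (c + 3 / 2 * A ^ 2) * T := by
  have hE : 0 < v 0 ^ 2 / 2 + c / 2 * y 0 ^ 2 + 3 / 8 * y 0 ^ 4 := by
    by_cases hy0 : y 0 = 0
    · have hv0 : v 0 ≠ 0 := fun h => h0 (by rw [hy0, h])
      positivity
    · positivity
  obtain ⟨A, hA, hAE⟩ := exists_duffing_amplitude hc hE
  obtain ⟨φ, hφ, hyφ⟩ := exists_duffing_phase hc hA hy hv hAE.symm
  obtain ⟨T, hT, hper, hT0, hT1⟩ := exists_duffing_period hc hA hφ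
  have habs : ∀ t, 0 ≤ t → |y t| = A * |Real.sin (φ t)| := fun t ht => by
    rw [hyφ t ht, abs_mul, abs_of_pos hA]
  have hle : ∀ t, 0 ≤ t → |y t| ≤ A := fun t ht => by
    rw [habs t ht]
    exact mul_le_of_le_one_right hA.le (Real.abs_sin_le_one _)
  refine ⟨A, T, hA, hT, hAE, ?_, fun t ht => ?_, fun t ht => ?_, hT0, hT1⟩
  · obtain ⟨t, ht, hs⟩ := exists_abs_sin_eq_one (k := Real.sqrt c) (Real.sqrt_pos.2 hc) hφ
      (fun t _ => Real.sqrt_le_sqrt (by nlinarith [sq_nonneg A, sq_nonneg (A * Real.sin (φ t))]))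
    refine le_antisymm (iSup₂_le fun s hs => ENNReal.ofReal_le_ofReal (hle s hs)) ?_
    have := habs t ht
    rw [hs, mul_one] at this
    rw [← this]
    exact le_iSup₂_of_le (f := fun t (_ : t ∈ Ici (0 : ℝ)) => ENNReal.ofReal |y t|) t ht le_rfl
  · exact sq_le_sq' (abs_le.1 (hle t ht)).1 (abs_le.1 (hle t ht)).2
  · rw [hyφ t ht, hyφ _ (add_nonneg ht hT.le), hper t ht, Real.sin_add_pi]
    ring

/-- The amplitude bound and the energy bound are the same condition, because the potential
energy is strictly increasing in the amplitude. -/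
lemma amplitude_le_iff {c A B E : ℝ} (hc : 0 < c) (hA : 0 < A) (hB : 0 ≤ B)
    (hE : c / 2 * A ^ 2 + 3 / 8 * A ^ 4 = E) :
    ENNReal.ofReal A ≤ ENNReal.ofReal B ↔ E ≤ c / 2 * B ^ 2 + 3 / 8 * B ^ 4 := by
  rw [ENNReal.ofReal_le_ofReal_iff hB, ← hE]
  constructor
  · intro h
    gcongr
  · intro h
    by_contra! hlt
    have h2 : B ^ 2 < A ^ 2 := by gcongr
    have h4 : B ^ 4 < A ^ 4 := by gcongr
    nlinarith

/-! ### A stability criterion for Hill's equation -/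

/-- Zhukovskii-type criterion. In the phase plane with coordinates `√M ξ`, `ξ'`, every solution of
`ξ'' + p ξ = 0` turns with a speed between `m / √M` and `√M`. If the turn over one period stays
strictly between two consecutive multiples of `π`, then the Wronskian of `ξ` and its translate by
`T`, which is constant in time, is comparable to `ξ² + ξ'²`. -/
lemma hill_bounded {p : ℝ → ℝ} {m M T : ℝ} (N : ℕ) (hm : 0 < m) (hT : 0 < T)
    (hpc : ContinuousOn p (Ici 0)) (hpm : ∀ t, 0 ≤ t → m ≤ p t) (hpM : ∀ t, 0 ≤ t → p t ≤ M)
    (hper : ∀ t, 0 ≤ t → p (t + T) = p t)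
    (hlow : N * Real.pi < m / Real.sqrt M * T) (hup : Real.sqrt M * T < (N + 1) * Real.pi) :
    ∃ K : ℝ, 0 < K ∧ ∀ ξ η : ℝ → ℝ, (∀ t, 0 ≤ t → HasDerivWithinAt ξ (η t) (Ici 0) t) →
      (∀ t, 0 ≤ t → HasDerivWithinAt η (-(p t * ξ t)) (Ici 0) t) →
      ∀ t, 0 ≤ t → M * ξ t ^ 2 + η t ^ 2 ≤ K * (M * ξ 0 ^ 2 + η 0 ^ 2) := by
  have hM : 0 < M := hm.trans_le ((hpm 0 le_rfl).trans (hpM 0 le_rfl))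
  set κ := Real.sqrt M with hκ
  have hκ0 : 0 < κ := Real.sqrt_pos.2 hM
  have hκM : κ ^ 2 = M := Real.sq_sqrt hM.le
  have hmM : m ≤ M := (hpm 0 le_rfl).trans (hpM 0 le_rfl)
  have hsin : ∃ s : ℝ, 0 < s ∧ ∀ x ∈ Icc (m / κ * T) (κ * T), s ≤ |Real.sin x| := by
    have hne : (Icc (m / κ * T) (κ * T)).Nonempty := by
      refine nonempty_Icc.2 (mul_le_mul_of_nonneg_right ?_ hT.le)
      rw [div_le_iff₀ hκ0, ← sq, hκM]
      exact hmM
    obtain ⟨x, hx, hmin⟩ := isCompact_Icc.exists_isMinOn hne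
      (f := fun x => |Real.sin x|) (by fun_prop)
    refine ⟨|Real.sin x|, abs_pos.2 fun h => ?_, fun z hz => hmin hz⟩
    have h1 : 0 < Real.sin (x - N * Real.pi) :=
      Real.sin_pos_of_pos_of_lt_pi (by linarith [hx.1]) (by linarith [hx.2])
    rw [Real.sin_sub_nat_mul_pi, h, mul_zero] at h1
    exact lt_irrefl _ h1
  obtain ⟨s, hs, hsmin⟩ := hsin
  set e := Real.exp (κ * T) with he
  have he0 : 0 < e := Real.exp_pos _
  refine ⟨e / s, by positivity, fun ξ η hξ hη t ht => ?_⟩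
  -- `R` is the squared radius; it changes at a rate of at most `κ`.
  set R : ℝ → ℝ := fun t => M * ξ t ^ 2 + η t ^ 2 with hR
  have hR0 : ∀ t, 0 ≤ R t := fun t => by positivity
  have hRd : ∀ t, 0 ≤ t → HasDerivWithinAt R (2 * (M - p t) * (ξ t * η t)) (Ici 0) t :=
    fun t ht => ((((hξ t ht).pow 2).const_mul M).add ((hη t ht).pow 2)).congr_deriv
      (by simp; ring)
  have hRb : ∀ t, 0 ≤ t → |2 * (M - p t) * (ξ t * η t)| ≤ κ * R t := fun t ht => by
    have h1 : |M - p t| ≤ M := abs_le.2 ⟨by linarith [hpM t ht], by linarith [hpm t ht]⟩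
    have h2 : 2 * κ * |ξ t * η t| ≤ R t := by
      simp only [hR, ← hκM]
      rw [abs_mul, ← sq_abs (ξ t), ← sq_abs (η t)]
      nlinarith [sq_nonneg (κ * |ξ t| - |η t|)]
    rw [abs_mul, abs_mul, abs_two]
    calc 2 * |M - p t| * |ξ t * η t| ≤ 2 * M * |ξ t * η t| := by gcongr
      _ = κ * (2 * κ * |ξ t * η t|) := by rw [← hκM]; ring
      _ ≤ κ * R t := by gcongr
  have hgr : ∀ a b, 0 ≤ a → a ≤ b → R a * Real.exp (-(κ * (b - a))) ≤ R b ∧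
      R b ≤ R a * Real.exp (κ * (b - a)) := fun a b ha hab =>
    gronwall_two_sided hRd (fun x hx _ => hRb x hx) ha hab le_rfl
  change R t ≤ e / s * R 0
  by_cases hz : R 0 = 0
  · have := (hgr 0 t le_rfl ht).2
    rw [hz, zero_mul] at this
    rw [hz, mul_zero]
    exact this
  have hRpos : ∀ t, 0 ≤ t → 0 < R t := fun t ht =>
    (mul_pos ((hR0 0).lt_of_ne' hz) (Real.exp_pos _)).trans_le (hgr 0 t le_rfl ht).1
  set r : ℝ → ℝ := fun t => Real.sqrt (R t) with hr
  have hrpos : ∀ t, 0 ≤ t → 0 < r t := fun t ht => Real.sqrt_pos.2 (hRpos t ht)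
  have hrsq : ∀ t, r t ^ 2 = R t := fun t => Real.sq_sqrt (hR0 t)
  have hrd : ∀ t, 0 ≤ t → HasDerivWithinAt r ((M - p t) * (ξ t * η t) / r t) (Ici 0) t :=
    fun t ht => ((hRd t ht).sqrt (hRpos t ht).ne').congr_deriv (by
      have := (hrpos t ht).ne'
      change _ / (2 * r t) = _
      field_simp)
  have hξc : ContinuousOn ξ (Ici 0) := fun t ht => (hξ t ht).continuousWithinAt
  have hηc : ContinuousOn η (Ici 0) := fun t ht => (hη t ht).continuousWithinAt
  have hRc : ContinuousOn R (Ici 0) := fun t ht => (hRd t ht).continuousWithinAt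
  obtain ⟨θ, hθ, hθr⟩ := exists_angle (u := fun t => κ * ξ t / r t) (w := fun t => η t / r t)
    (ω := fun t => κ * (η t ^ 2 + p t * ξ t ^ 2) / R t)
    (ContinuousOn.div (by fun_prop) hRc fun t ht => (hRpos t ht).ne')
    (fun t ht => (((hξ t ht).const_mul κ).div (hrd t ht) (hrpos t ht).ne').congr_deriv (by
      have h1 := (hrpos t ht).ne'
      have h2 := hrsq t
      have h3 := hrsq t
      simp only [hR] at h3
      rw [← h2]
      field_simp
      linear_combination (η t) * h3))
    (fun t ht => ((hη t ht).div (hrd t ht) (hrpos t ht).ne').congr_deriv (by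
      have h1 := (hrpos t ht).ne'
      have h2 := hrsq t
      have h3 := hrsq t
      simp only [hR] at h3
      rw [← h2]
      field_simp
      rw [hκM]
      linear_combination (-(p t * ξ t)) * h3))
    (by
      have h1 := (hrpos 0 le_rfl).ne'
      have h3 := hrsq 0
      simp only [hR] at h3
      field_simp
      rw [hκM]
      linarith)
  have hlo : ∀ t, 0 ≤ t → m / κ ≤ κ * (η t ^ 2 + p t * ξ t ^ 2) / R t := fun t ht => by
    rw [div_le_div_iff₀ hκ0 (hRpos t ht)]
    rw [mul_right_comm κ, ← sq, hκM]
    simp only [hR]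
    nlinarith [mul_le_mul_of_nonneg_right hmM (sq_nonneg (η t)),
      mul_le_mul_of_nonneg_right (hpm t ht) (mul_nonneg hM.le (sq_nonneg (ξ t)))]
  have hhi : ∀ t, 0 ≤ t → κ * (η t ^ 2 + p t * ξ t ^ 2) / R t ≤ κ := fun t ht => by
    rw [div_le_iff₀ (hRpos t ht)]
    simp only [hR]
    gcongr ?_ * ?_
    nlinarith [mul_le_mul_of_nonneg_right (hpM t ht) (sq_nonneg (ξ t))]
  have hTt : ∀ {t : ℝ}, 0 ≤ t → 0 ≤ t + T := fun ht => add_nonneg ht hT.le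
  set Q : ℝ → ℝ := fun t => κ * (ξ (t + T) * η t - η (t + T) * ξ t) with hQ
  have hQr : ∀ t, 0 ≤ t → |Q t| = r t * r (t + T) * |Real.sin (θ (t + T) - θ t)| := fun t ht => by
    have h1 := hrpos t ht
    have h2 := hrpos _ (hTt ht)
    rw [Real.sin_sub, ← (hθr t ht).1, ← (hθr t ht).2, ← (hθr _ (hTt ht)).1,
      ← (hθr _ (hTt ht)).2, ← abs_of_pos h1, ← abs_of_pos h2, ← abs_mul, ← abs_mul,
      abs_of_pos h1, abs_of_pos h2]
    congr 1
    simp only [hQ]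
    field_simp
  have hQc : Q t = Q 0 := by
    have hshift : ∀ {f : ℝ → ℝ} {f' t : ℝ}, 0 ≤ t → HasDerivWithinAt f f' (Ici 0) (t + T) →
        HasDerivWithinAt (fun t => f (t + T)) f' (Ici 0) t := fun {f f' t} ht hf => by
      have := hf.scomp t ((hasDerivWithinAt_id t (Ici 0)).add_const T)
        (fun x hx => hTt hx)
      exact this.congr_deriv (by simp)
    refine eq_of_hasDerivWithinAt_zero (f' := fun _ => 0) (fun t ht => ?_) (fun _ _ => rfl) ht
    refine ((((hshift ht (hξ _ (hTt ht))).mul (hη t ht)).sub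
      ((hshift ht (hη _ (hTt ht))).mul (hξ t ht))).const_mul κ).congr_deriv ?_
    rw [hper t ht]
    ring
  have hrT : ∀ t, 0 ≤ t → R t ≤ e * R (t + T) ∧ R (t + T) ≤ e * R t := fun t ht => by
    have := hgr t (t + T) ht (by linarith)
    rw [add_sub_cancel_left, Real.exp_neg, ← div_eq_mul_inv, div_le_iff₀ he0] at this
    exact ⟨by linarith [this.1], by linarith [this.2]⟩
  have hrt : ∀ t, 0 ≤ t → r t ≤ Real.sqrt e * r (t + T) ∧ r (t + T) ≤ Real.sqrt e * r t :=
    fun t ht => by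
      simp only [hr, ← Real.sqrt_mul he0.le]
      exact ⟨Real.sqrt_le_sqrt (hrT t ht).1, Real.sqrt_le_sqrt (hrT t ht).2⟩
  have hang : s ≤ |Real.sin (θ (t + T) - θ t)| := by
    have h1 := mul_le_sub_of_le_hasDerivWithinAt hθ hlo ht (le_add_of_nonneg_right hT.le)
    have h2 := sub_le_mul_of_hasDerivWithinAt_le hθ hhi ht (le_add_of_nonneg_right hT.le)
    rw [add_sub_cancel_left] at h1 h2
    exact hsmin _ ⟨h1, h2⟩
  have hse : Real.sqrt e * Real.sqrt e = e := Real.mul_self_sqrt he0.le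
  rw [div_mul_eq_mul_div, le_div_iff₀ hs]
  have hrt0 := (hrpos t ht).le
  have hr00 := (hrpos 0 le_rfl).le
  have key : R t * s ≤ Real.sqrt e * |Q t| := by
    rw [hQr t ht, ← hrsq t, sq]
    calc r t * r t * s ≤ r t * (Real.sqrt e * r (t + T)) * |Real.sin (θ (t + T) - θ t)| := by
          gcongr
          exact (hrt t ht).1
      _ = _ := by ring
  have key0 : |Q 0| ≤ Real.sqrt e * R 0 := by
    rw [hQr 0 le_rfl, ← hrsq 0, sq]
    calc r 0 * r (0 + T) * |Real.sin (θ (0 + T) - θ 0)| ≤ r 0 * (Real.sqrt e * r 0) * 1 := by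
          gcongr
          · exact (hrt 0 le_rfl).2
          · exact Real.abs_sin_le_one _
      _ = _ := by ring
  calc R t * s ≤ Real.sqrt e * |Q 0| := by rw [← hQc]; exact key
    _ ≤ Real.sqrt e * (Real.sqrt e * R 0) := by gcongr
    _ = e * R 0 := by rw [← mul_assoc, hse]

/-! ### Reduction of the stability of a mode to two Hill equations -/

/-- The a priori bound on solutions of `ξ'' + p ξ = 0` in the norm `M ξ² + (ξ')²`, with a constant
that does not depend on the solution. -/
def HillBounded (p : ℝ → ℝ) : Prop :=
  ∃ M K : ℝ, 0 < M ∧ 0 < K ∧ ∀ ξ η : ℝ → ℝ,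
    (∀ t, 0 ≤ t → HasDerivWithinAt ξ (η t) (Ici 0) t) →
    (∀ t, 0 ≤ t → HasDerivWithinAt η (-(p t * ξ t)) (Ici 0) t) →
    ∀ t, 0 ≤ t → M * ξ t ^ 2 + η t ^ 2 ≤ K * (M * ξ 0 ^ 2 + η 0 ^ 2)

lemma HillBounded.exists_delta {p : ℝ → ℝ} (h : HillBounded p) {ε : ℝ} (hε : 0 < ε) :
    ∃ δ > 0, ∀ ξ η : ℝ → ℝ,
      (∀ t, 0 ≤ t → HasDerivWithinAt ξ (η t) (Ici 0) t) →
      (∀ t, 0 ≤ t → HasDerivWithinAt η (-(p t * ξ t)) (Ici 0) t) →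
      |ξ 0| < δ → |η 0| < δ → ∀ t, 0 ≤ t → |ξ t| < ε ∧ |η t| < ε := by
  obtain ⟨M, K, hM, hK, h⟩ := h
  have hmin : 0 < min M 1 := lt_min hM one_pos
  have hden : 0 < K * (M + 1) := by positivity
  have hδ : 0 < min M 1 / (K * (M + 1)) := by positivity
  refine ⟨ε * Real.sqrt (min M 1 / (K * (M + 1))), by positivity, fun ξ η hξ hη h0 h1 t ht => ?_⟩
  have hb := h ξ η hξ hη t ht
  have h0' := sq_lt_sq' (neg_lt_of_abs_lt h0) (lt_of_abs_lt h0)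
  have h1' := sq_lt_sq' (neg_lt_of_abs_lt h1) (lt_of_abs_lt h1)
  rw [mul_pow, Real.sq_sqrt hδ.le] at h0' h1'
  have hlt : M * ξ t ^ 2 + η t ^ 2 < min M 1 * ε ^ 2 := by
    calc M * ξ t ^ 2 + η t ^ 2 ≤ K * (M * ξ 0 ^ 2 + η 0 ^ 2) := hb
      _ < K * (M * (ε ^ 2 * (min M 1 / (K * (M + 1)))) + ε ^ 2 * (min M 1 / (K * (M + 1)))) := by
        gcongr
      _ = min M 1 * ε ^ 2 := by field_simp
  have hε2 : 0 ≤ ε ^ 2 := sq_nonneg ε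
  constructor
  · refine abs_lt_of_sq_lt_sq ?_ hε.le
    have : M * ξ t ^ 2 < M * ε ^ 2 := by
      nlinarith [mul_le_mul_of_nonneg_right (min_le_left M 1) hε2, sq_nonneg (η t)]
    exact lt_of_mul_lt_mul_left this hM.le
  · refine abs_lt_of_sq_lt_sq ?_ hε.le
    nlinarith [mul_le_mul_of_nonneg_right (min_le_right M 1) hε2,
      mul_nonneg hM.le (sq_nonneg (ξ t))]

lemma trivialSolutionStable_of_diagonal {m : ℕ} {P : ℝ → Matrix (Fin m) (Fin m) ℝ}
    {p : Fin m → ℝ → ℝ} (hP : ∀ t, 0 ≤ t → P t = Matrix.diagonal fun i => p i t)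
    (hp : ∀ i, HillBounded (p i)) : TrivialSolutionStable P := by
  intro ε hε
  choose δ hδ h using fun i => (hp i).exists_delta hε
  obtain ⟨d, hd, hdδ⟩ : ∃ d > 0, ∀ i, d ≤ δ i := by
    obtain ⟨d, hd⟩ := (Set.finite_range fun i => (δ i)⁻¹).bddAbove
    refine ⟨(max d 1)⁻¹, by positivity, fun i => ?_⟩
    exact inv_le_of_inv_le₀ (hδ i) ((hd (mem_range_self i)).trans (le_max_left _ _))
  refine ⟨d, hd, fun ξ ξ' hs h0 h1 t ht => ?_⟩
  have key : ∀ i, |ξ t i| < ε ∧ |ξ' t i| < ε := fun i => by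
    refine h i (fun t => ξ t i) (fun t => ξ' t i)
      (fun t ht => hasDerivWithinAt_pi.1 (hs t ht).1 i) (fun t ht => ?_)
      (((norm_le_pi_norm (ξ 0) i).trans_lt h0).trans_le (hdδ i))
      (((norm_le_pi_norm (ξ' 0) i).trans_lt h1).trans_le (hdδ i)) t ht
    refine (hasDerivWithinAt_pi.1 (hs t ht).2 i).congr_deriv ?_
    simp [hP t ht, Matrix.mulVec_diagonal]
  exact ⟨(pi_norm_lt_iff hε).2 fun i => (key i).1, (pi_norm_lt_iff hε).2 fun i => (key i).2⟩

/-- Hill's equation with `p = a + b y²`, where `y²` has period `T` and values in `[0, A²]`. -/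
lemma hillBounded_of_sq {a b A T : ℝ} (N : ℕ) {y : ℝ → ℝ} (ha : 0 < a) (hb : 0 ≤ b) (hT : 0 < T)
    (hyc : ContinuousOn y (Ici 0)) (hyA : ∀ t, 0 ≤ t → y t ^ 2 ≤ A ^ 2)
    (hper : ∀ t, 0 ≤ t → y (t + T) ^ 2 = y t ^ 2)
    (hlow : N * Real.pi < a / Real.sqrt (a + b * A ^ 2) * T)
    (hup : Real.sqrt (a + b * A ^ 2) * T < (N + 1) * Real.pi) :
    HillBounded fun t => a + b * y t ^ 2 := by
  obtain ⟨K, hK, h⟩ := hill_bounded (p := fun t => a + b * y t ^ 2) N ha hT (by fun_prop)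
    (fun t _ => le_add_of_nonneg_right (by positivity))
    (fun t ht => by have := hyA t ht; gcongr)
    (fun t ht => by simp only [hper t ht]) hlow hup
  exact ⟨a + b * A ^ 2, K, by positivity, hK, h⟩

lemma lt_div_sqrt_mul {a M ω T : ℝ} (ha : 0 ≤ a) (hM : 0 < M) (hT : 0 < T)
    (h : Real.pi < Real.sqrt ω * T) (hω : ω * M ≤ a ^ 2) :
    Real.pi < a / Real.sqrt M * T := by
  refine h.trans_le (mul_le_mul_of_nonneg_right ?_ hT.le)
  rw [le_div_iff₀ (Real.sqrt_pos.2 hM), ← Real.sqrt_mul' _ hM.le]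
  exact Real.sqrt_le_iff.2 ⟨ha, hω⟩

lemma sqrt_mul_lt {M ω T b : ℝ} (hb : 0 < b) (hT : 0 < T) (h : Real.sqrt ω * T < Real.pi)
    (hω : M ≤ b ^ 2 * ω) : Real.sqrt M * T < b * Real.pi := by
  have h1 : Real.sqrt M ≤ b * Real.sqrt ω := by
    have := Real.sqrt_le_sqrt hω
    rwa [Real.sqrt_mul (sq_nonneg b), Real.sqrt_sq hb.le] at this
  calc Real.sqrt M * T ≤ b * Real.sqrt ω * T := by gcongr
    _ = b * (Real.sqrt ω * T) := by ring
    _ < b * Real.pi := by gcongr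

/-- A vertical mode in coordinates, with `v` the velocity of `Y`. -/
lemma IsVerticalMode.exists_coords {k : Fin 2} {α β : ℝ} {Y : ℝ → Fin 2 → ℝ}
    (h : IsVerticalMode 2 k α β Y) :
    ∃ v : ℝ → Fin 2 → ℝ, Y 0 = Pi.single k α ∧ v 0 = Pi.single k β ∧
      (∀ i t, 0 ≤ t → HasDerivWithinAt (fun t => Y t i) (v t i) (Ici 0) t) ∧
      (∀ t, 0 ≤ t → HasDerivWithinAt (fun t => v t 0)
        (-((3 + 3 / 2 * Y t 0 ^ 2 + 3 * Y t 1 ^ 2) * Y t 0)) (Ici 0) t) ∧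
      (∀ t, 0 ≤ t → HasDerivWithinAt (fun t => v t 1)
        (-((18 + 3 / 2 * Y t 1 ^ 2 + 3 * Y t 0 ^ 2) * Y t 1)) (Ici 0) t) := by
  obtain ⟨-, v, hs, hY, hv⟩ := h
  have h1 : ∀ t, 0 ≤ t → HasDerivWithinAt Y (v t) (Ici 0) t := fun t ht =>
    (hs t ht).1.hasFDerivWithinAt.fst.hasDerivWithinAt.congr_deriv (by simp)
  have h2 : ∀ t, 0 ≤ t → HasDerivWithinAt v (-(force 2 (Y t, 0)).1) (Ici 0) t := fun t ht =>
    (hs t ht).2.hasFDerivWithinAt.fst.hasDerivWithinAt.congr_deriv (by simp)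
  refine ⟨v, hY, hv, fun i t ht => hasDerivWithinAt_pi.1 (h1 t ht) i, fun t ht => ?_,
    fun t ht => ?_⟩
  · refine (hasDerivWithinAt_pi.1 (h2 t ht) 0).congr_deriv ?_
    simp [force_two]
    ring
  · refine (hasDerivWithinAt_pi.1 (h2 t ht) 1).congr_deriv ?_
    simp [force_two]
    ring

lemma IsVerticalMode.first {α β : ℝ} {Y : ℝ → Fin 2 → ℝ} (h : IsVerticalMode 2 0 α β Y) :
    (∀ t, 0 ≤ t → Y t 1 = 0) ∧
      (supNorm (fun t => Y t 0) ≤ ENNReal.ofReal (1 / Real.sqrt 3) ↔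
        modeEnergy 2 0 α β ≤ 13 / 24) ∧
      (supNorm (fun t => Y t 0) ≤ ENNReal.ofReal (1 / Real.sqrt 3) →
        IsTorsionallyStable 2 Y) := by
  obtain ⟨v, hY0, hv0, hY, hva, hvb⟩ := h.exists_coords
  have hc : ∀ i, ContinuousOn (fun t => Y t i) (Ici 0) :=
    fun i t ht => (hY i t ht).continuousWithinAt
  have hc0 := hc 0
  have hc1 := hc 1
  have hz : ∀ t, 0 ≤ t → Y t 1 = 0 := fun t ht =>
    eq_zero_of_linear (c := fun t => 18 + 3 / 2 * Y t 1 ^ 2 + 3 * Y t 0 ^ 2) (by fun_prop)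
      (hY 1) hvb (by simp [hY0]) (by simp [hv0]) ht
  obtain ⟨A, T, hA, hT, hAE, hsup, hyA, hper, hT0, hT1⟩ := duffing_summary (c := 3) (by norm_num)
    (hY 0) (fun t ht => (hva t ht).congr_deriv (by rw [hz t ht]; ring))
    (by simpa [hY0, hv0] using h.1)
  simp only [hY0, hv0, Pi.single_eq_same] at hAE
  have hiff := amplitude_le_iff (B := 1 / Real.sqrt 3) (by norm_num) hA (by positivity) hAE
  have hB : (1 / Real.sqrt 3) ^ 2 = 1 / 3 := by rw [div_pow, Real.sq_sqrt (by norm_num)]; norm_num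
  rw [hsup]
  refine ⟨hz, ?_, fun hle => ?_⟩
  · rw [hiff, show (1 / Real.sqrt 3) ^ 4 = ((1 / Real.sqrt 3) ^ 2) ^ 2 by ring, hB,
      modeEnergy_two_zero]
    norm_num
  · have hA2 : A ^ 2 ≤ 1 / 3 := by
      rw [← hB]
      have := (ENNReal.ofReal_le_ofReal_iff (by positivity)).1 hle
      gcongr
    have hA0 : 0 ≤ A ^ 2 := sq_nonneg A
    refine trivialSolutionStable_of_diagonal
      (p := ![fun t => 7 + 27 / 2 * Y t 0 ^ 2, fun t => 10 + 9 * Y t 0 ^ 2])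
      (fun t ht => ?_) (Fin.forall_fin_two.2 ⟨?_, ?_⟩)
    · rw [torsionalMatrix_two]
      ext i j
      fin_cases i <;> fin_cases j <;> simp [hz t ht]
    -- `N = 1`: with `M` the maximum of the coefficient, the bounds on `T` reduce the claim to
    -- `(3 + 3/2 A²) M ≤ a²` and `M ≤ 4 (3 + 3/4 A²)`; the latter is sharp for `a = 10`.
    · refine hillBounded_of_sq 1 (by norm_num) (by norm_num) hT hc0 hyA hper ?_ ?_
      · rw [Nat.cast_one, one_mul]
        exact lt_div_sqrt_mul (by norm_num) (by positivity) hT hT1 (by nlinarith)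
      · exact sqrt_mul_lt (by positivity) hT hT0 (by norm_num; linarith)
    · refine hillBounded_of_sq 1 (by norm_num) (by norm_num) hT hc0 hyA hper ?_ ?_
      · rw [Nat.cast_one, one_mul]
        exact lt_div_sqrt_mul (by norm_num) (by positivity) hT hT1 (by nlinarith)
      · exact sqrt_mul_lt (by positivity) hT hT0 (by norm_num; linarith)

lemma IsVerticalMode.second {α β : ℝ} {Y : ℝ → Fin 2 → ℝ} (h : IsVerticalMode 2 1 α β Y) :
    (∀ t, 0 ≤ t → Y t 0 = 0) ∧
      (supNorm (fun t => Y t 1) ≤ ENNReal.ofReal (Real.sqrt (32 / 51)) ↔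
        modeEnergy 2 1 α β ≤ 5024 / 867) ∧
      (supNorm (fun t => Y t 1) ≤ ENNReal.ofReal (Real.sqrt (32 / 51)) →
        IsTorsionallyStable 2 Y) := by
  obtain ⟨v, hY0, hv0, hY, hva, hvb⟩ := h.exists_coords
  have hc : ∀ i, ContinuousOn (fun t => Y t i) (Ici 0) :=
    fun i t ht => (hY i t ht).continuousWithinAt
  have hc0 := hc 0
  have hc1 := hc 1
  have hz : ∀ t, 0 ≤ t → Y t 0 = 0 := fun t ht =>
    eq_zero_of_linear (c := fun t => 3 + 3 / 2 * Y t 0 ^ 2 + 3 * Y t 1 ^ 2) (by fun_prop)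
      (hY 0) hva (by simp [hY0]) (by simp [hv0]) ht
  obtain ⟨A, T, hA, hT, hAE, hsup, hyA, hper, hT0, hT1⟩ := duffing_summary (c := 18) (by norm_num)
    (hY 1) (fun t ht => (hvb t ht).congr_deriv (by rw [hz t ht]; ring))
    (by simpa [hY0, hv0] using h.1)
  simp only [hY0, hv0, Pi.single_eq_same] at hAE
  have hiff := amplitude_le_iff (B := Real.sqrt (32 / 51)) (by norm_num) hA (by positivity) hAE
  have hB : Real.sqrt (32 / 51) ^ 2 = 32 / 51 := Real.sq_sqrt (by norm_num)
  rw [hsup]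
  refine ⟨hz, ?_, fun hle => ?_⟩
  · rw [hiff, show Real.sqrt (32 / 51) ^ 4 = (Real.sqrt (32 / 51) ^ 2) ^ 2 by ring, hB,
      modeEnergy_two_one]
    norm_num
  · have hA2 : A ^ 2 ≤ 32 / 51 := by
      rw [← hB]
      have := (ENNReal.ofReal_le_ofReal_iff (by positivity)).1 hle
      gcongr
    have hA0 : 0 ≤ A ^ 2 := sq_nonneg A
    refine trivialSolutionStable_of_diagonal
      (p := ![fun t => 7 + 9 * Y t 1 ^ 2, fun t => 10 + 27 / 2 * Y t 1 ^ 2])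
      (fun t ht => ?_) (Fin.forall_fin_two.2 ⟨?_, ?_⟩)
    · rw [torsionalMatrix_two]
      ext i j
      fin_cases i <;> fin_cases j <;> simp [hz t ht]
    -- `N = 0`: only `M ≤ 18 + 3/4 A²` is needed, which is sharp for `a = 10`.
    · refine hillBounded_of_sq 0 (by norm_num) (by norm_num) hT hc1 hyA hper ?_ ?_
      · rw [Nat.cast_zero, zero_mul]
        positivity
      · exact sqrt_mul_lt (by positivity) hT hT0 (by norm_num; linarith)
    · refine hillBounded_of_sq 0 (by norm_num) (by norm_num) hT hc1 hyA hper ?_ ?_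
      · rw [Nat.cast_zero, zero_mul]
        positivity
      · exact sqrt_mul_lt (by positivity) hT hT0 (by norm_num; linarith)

end FishBone

/-- Torsional stability of the two vertical modes of the 2-mode projected system. The first
vertical mode has index `0`, the second has index `1`. -/
theorem theorem5p1 :
    (∀ (α β : ℝ) (Y : ℝ → Fin 2 → ℝ), FishBone.IsVerticalMode 2 0 α β Y →
      (∀ t, 0 ≤ t → Y t 1 = 0) ∧
      (FishBone.supNorm (fun t => Y t 0) ≤ ENNReal.ofReal (1 / Real.sqrt 3) ↔
        FishBone.modeEnergy 2 0 α β ≤ 13 / 24) ∧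
      (FishBone.supNorm (fun t => Y t 0) ≤ ENNReal.ofReal (1 / Real.sqrt 3) →
        FishBone.IsTorsionallyStable 2 Y)) ∧
    (∀ (α β : ℝ) (Y : ℝ → Fin 2 → ℝ), FishBone.IsVerticalMode 2 1 α β Y →
      (∀ t, 0 ≤ t → Y t 0 = 0) ∧
      (FishBone.supNorm (fun t => Y t 1) ≤ ENNReal.ofReal (Real.sqrt (32 / 51)) ↔
        FishBone.modeEnergy 2 1 α β ≤ 5024 / 867) ∧
      (FishBone.supNorm (fun t => Y t 1) ≤ ENNReal.ofReal (Real.sqrt (32 / 51)) →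
        FishBone.IsTorsionallyStable 2 Y)) :=
  ⟨fun _ _ _ h => h.first, fun _ _ _ h => h.second⟩
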